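/- Let $M$ be a nonempty smooth compact manifold of dimension at least $1$ (possibly with boundary or corners), and let $d$ be a metric inducing its topology. Let $\mathrm{Hom}(M)$ be the set of homeomorphisms of $M$, with the metric $$d_H(f,g)=\max_{x\in M}\max\bigl\{d(f(x),g(x)),\,d(f^{-1}(x),g^{-1}(x))\bigr\}.$$ For $f\in \mathrm{Hom}(M)$, a continuous function $u:M\to\mathbb R$ is a Lyapunov function for $f$ if $u(f(x))\le u(x)$ for all $x\in M$; it is strict if $u(f(x))<u(x)$ for at least one $x\in M$. The generalized recurrent set is $\mathcal{GR}(f)=\bigcap_{\delta}\mathcal{SCR}_\delta(f)$, where $\delta$ runs over all metrics inducing the topology of $M$, and $\mathcal{SCR}_\delta(f)$ is the set of points $x$ such that for every $\varepsilon>0$ there are $n\ge 1$ and points $x=x_1,x_2,\dots,x_{n+1}=x$ in $M$ with $\sum_{i=1}^n\delta(f(x_i),x_{i+1})<\varepsilon$. Then: 1. $(\mathrm{Hom}(M),d_H)$ is a complete metric space. 2. For every $f\in\mathrm{Hom}(M)$, $f$ admits a continuous strict Lyapunov function if and only if $\mathcal{GR}(f)\ne M$. 3. The property of admitting a continuous strict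 Lyapunov function is generic in $\mathrm{Hom}(M)$: the set of $f\in\mathrm{Hom}(M)$ that admit one contains a countable intersection of open dense subsets of $\mathrm{Hom}(M)$. Equivalently, the set of $f$ with $\mathcal{GR}(f)\ne M$ contains such an intersection. -/

import Mathlib

open scoped Manifold ContDiff

namespace GenericLyapunov

/-! ### Generalized recurrence and Lyapunov functions -/

section Recurrence

variable {X : Type*}

/-- There is a strong `ε`-chain for `f` from `x` to `y` with respect to the distance function `d`:
points `x = c 0, c 1, …, c n = y` with `n ≥ 1` and `∑_{i < n} d (f (c i)) (c (i + 1)) < ε`. -/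
def StrongChain (d : X → X → ℝ) (f : X → X) (ε : ℝ) (x y : X) : Prop :=
  ∃ n : ℕ, 1 ≤ n ∧ ∃ c : ℕ → X, c 0 = x ∧ c n = y ∧
    ∑ i ∈ Finset.range n, d (f (c i)) (c (i + 1)) < ε

/-- The strong chain recurrent set `SCR_d(f)`. -/
def strongChainRecurrentSet (d : X → X → ℝ) (f : X → X) : Set X :=
  {x | ∀ ε : ℝ, 0 < ε → StrongChain d f ε x x}

/-- The generalized recurrent set `GR(f)`: the intersection of the sets `SCR_d(f)` over all
metrics `d` that induce the given topology of `X`. -/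
def generalizedRecurrentSet [t : TopologicalSpace X] (f : X → X) : Set X :=
  {x | ∀ m : MetricSpace X, m.toUniformSpace.toTopologicalSpace = t →
    x ∈ strongChainRecurrentSet m.dist f}

/-- `u` is a continuous Lyapunov function for `f`. -/
def IsLyapunov [TopologicalSpace X] (f : X → X) (u : X → ℝ) : Prop :=
  Continuous u ∧ ∀ x, u (f x) ≤ u x

/-- The neutral set of `u`. -/
def neutralSet (f : X → X) (u : X → ℝ) : Set X :=
  {x | u (f x) = u x}

/-- `f` admits a continuous strict Lyapunov function, i.e. a continuous Lyapunov function that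
is not a first integral. -/
def AdmitsStrictLyapunov [TopologicalSpace X] (f : X → X) : Prop :=
  ∃ u : X → ℝ, IsLyapunov f u ∧ neutralSet f u ≠ Set.univ

end Recurrence

/-! ### The space of homeomorphisms of a compact metric space -/

section HomeoMetric

variable {X : Type*} [MetricSpace X]

/-- `d_H(f, g) = max_x max (d (f x) (g x)) (d (f⁻¹ x) (g⁻¹ x))`. -/
noncomputable def homeoDist (f g : X ≃ₜ X) : ℝ :=
  ⨆ x : X, max (dist (f x) (g x)) (dist (f.symm x) (g.symm x))

theorem bddAbove_homeoDist [CompactSpace X] (f g : X ≃ₜ X) :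
    BddAbove (Set.range fun x : X => max (dist (f x) (g x)) (dist (f.symm x) (g.symm x))) :=
  (isCompact_range (by fun_prop)).bddAbove

theorem le_homeoDist [CompactSpace X] (f g : X ≃ₜ X) (x : X) :
    max (dist (f x) (g x)) (dist (f.symm x) (g.symm x)) ≤ homeoDist f g :=
  le_ciSup (bddAbove_homeoDist f g) x

theorem homeoDist_nonneg (f g : X ≃ₜ X) : 0 ≤ homeoDist f g :=
  Real.iSup_nonneg fun _ => le_max_of_le_left dist_nonneg

/-- The metric `d_H` on the set of homeomorphisms of `X`; topological notions about
`X ≃ₜ X` refer to it. -/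
noncomputable instance homeoMetricSpace [CompactSpace X] : MetricSpace (X ≃ₜ X) where
  dist := homeoDist
  dist_self f := by simp [homeoDist]
  dist_comm f g := by simp only [homeoDist, dist_comm]
  dist_triangle f g h := by
    refine Real.iSup_le (fun x => ?_) (add_nonneg (homeoDist_nonneg _ _) (homeoDist_nonneg _ _))
    have h1 := max_le_iff.1 (le_homeoDist f g x)
    have h2 := max_le_iff.1 (le_homeoDist g h x)
    exact max_le ((dist_triangle _ _ _).trans (add_le_add h1.1 h2.1))
      ((dist_triangle _ _ _).trans (add_le_add h1.2 h2.2))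
  eq_of_dist_eq_zero := by
    intro f g h
    ext x
    exact dist_le_zero.1 (((max_le_iff.1 (le_homeoDist f g x)).1).trans h.le)

end HomeoMetric

end GenericLyapunov

/-!
For a fixed metric, the infimal total jump of a chain from `x` to `y` is a continuous Lyapunov
function of `y`, and it drops strictly at `x` when `x` is not strong chain recurrent. Conversely,
a continuous function `u` becomes `1`-Lipschitz for the metric induced from the graph of `u`. If
`u` is Lyapunov, it can then rise along a chain only through the jumps, so it does not drop at a
recurrent point. Thus `GR(f)` is the intersection of the neutral sets of all Lyapunov functions.

If an iterate of `f` maps a compact set `A` into an open set `W ⊂ A`, then a Urysohn function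
separating the image of `A` from the complement of `W` is a strict Lyapunov function for the
iterate, and its Birkhoff sum is one for `f`. This trapping condition is open.

It is also dense. Fill a dense open part of the space with finitely many small cells. By Baire some
orbit stays in their union forever, hence by pigeonhole it returns to one of its cells; take the
first return. A homeomorphism supported in that cell, hence close to the identity, can squeeze a
large ball of the cell into a small ball around the point where the orbit left, which traps the
perturbed iterate.
-/

namespace GenericLyapunov

open Set Filter Topology TopologicalSpace

section Recurrence

variable {X : Type*} {d : X → X → ℝ} {f : X → X} {ε : ℝ} {x y z : X}

theorem strongChain_iff_exists_sum_add_lt :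
    StrongChain d f ε x y ↔ ∃ (n : ℕ) (c : ℕ → X), c 0 = x ∧
      ∑ i ∈ Finset.range n, d (f (c i)) (c (i + 1)) + d (f (c n)) y < ε := by
  constructor
  · rintro ⟨_ | n, hn, c, hx, rfl, hlt⟩
    · omega
    · exact ⟨n, c, hx, by rwa [← Finset.sum_range_succ]⟩
  · rintro ⟨n, c, hx, hlt⟩
    refine ⟨n + 1, by omega, Function.update c (n + 1) y, by simpa using hx, by simp, ?_⟩
    have hsum : ∀ i ∈ Finset.range n,
        d (f (Function.update c (n + 1) y i)) (Function.update c (n + 1) y (i + 1)) =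
          d (f (c i)) (c (i + 1)) := fun i hi => by
      have := Finset.mem_range.1 hi
      rw [Function.update_of_ne (by omega), Function.update_of_ne (by omega)]
    rw [Finset.sum_range_succ, Finset.sum_congr rfl hsum]
    simpa using hlt

theorem StrongChain.single (h : d (f x) y < ε) : StrongChain d f ε x y :=
  strongChain_iff_exists_sum_add_lt.2 ⟨0, fun _ => x, rfl, by simpa using h⟩

theorem StrongChain.mono {ε' : ℝ} (h : StrongChain d f ε x y) (hε : ε ≤ ε') :
    StrongChain d f ε' x y :=
  let ⟨n, hn, c, hx, hy, hlt⟩ := h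
  ⟨n, hn, c, hx, hy, hlt.trans_le hε⟩

theorem StrongChain.snoc (h : StrongChain d f ε x y) (z : X) :
    StrongChain d f (ε + d (f y) z) x z := by
  obtain ⟨n, -, c, hx, rfl, hlt⟩ := h
  exact strongChain_iff_exists_sum_add_lt.2 ⟨n, c, hx, by gcongr⟩

/-- A Lyapunov function that is `1`-Lipschitz for `d` can increase along a chain only through the
jumps. -/
theorem StrongChain.apply_lt_apply_map_add {u : X → ℝ} (hu : ∀ x, u (f x) ≤ u x)
    (hud : ∀ x y, u y ≤ u x + d x y) (h : StrongChain d f ε x y) : u y < u (f x) + ε := by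
  obtain ⟨n, c, rfl, hlt⟩ := strongChain_iff_exists_sum_add_lt.1 h
  have hsum : ∀ k, u (f (c k)) ≤
      u (f (c 0)) + ∑ i ∈ Finset.range k, d (f (c i)) (c (i + 1)) := fun k => by
    induction k with
    | zero => simp
    | succ k ih =>
      rw [Finset.sum_range_succ]
      linarith [hu (c (k + 1)), hud (f (c k)) (c (k + 1))]
  linarith [hsum n, hud (f (c n)) y]

/-- The infimal total jump of the chains for `f` from `x` to `y` (the barrier of Fathi and
Pageault). As a function of `y` it is a Lyapunov function. -/
noncomputable def chainCost [PseudoMetricSpace X] (f : X → X) (x y : X) : ℝ :=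
  sInf {ε | StrongChain dist f ε x y}

section ChainCost

variable [PseudoMetricSpace X]

theorem StrongChain.pos (h : StrongChain dist f ε x y) : 0 < ε :=
  let ⟨_, _, _, _, _, hlt⟩ := h
  (Finset.sum_nonneg fun _ _ => dist_nonneg).trans_lt hlt

theorem StrongChain.add_dist (h : StrongChain dist f ε x y) (z : X) :
    StrongChain dist f (ε + dist y z) x z := by
  obtain ⟨n, c, hx, hlt⟩ := strongChain_iff_exists_sum_add_lt.1 h
  exact strongChain_iff_exists_sum_add_lt.2
    ⟨n, c, hx, by linarith [dist_triangle (f (c n)) y z]⟩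

theorem chainCost_lt_iff : chainCost f x y < ε ↔ StrongChain dist f ε x y := by
  constructor
  · intro h
    have hne : {ε | StrongChain dist f ε x y}.Nonempty :=
      ⟨_, .single (lt_add_one (dist (f x) y))⟩
    obtain ⟨ε', hchain, hlt⟩ := exists_lt_of_csInf_lt hne h
    exact hchain.mono hlt.le
  · rintro ⟨n, hn, c, hx, hy, hlt⟩
    obtain ⟨ε', hlt', hε'⟩ := exists_between hlt
    have hbdd : BddBelow {ε | StrongChain dist f ε x y} := ⟨0, fun _ h => h.pos.le⟩
    have hchain : StrongChain dist f ε' x y := ⟨n, hn, c, hx, hy, hlt'⟩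
    exact (csInf_le hbdd hchain).trans_lt hε'

theorem mem_strongChainRecurrentSet_iff_chainCost_le :
    x ∈ strongChainRecurrentSet dist f ↔ chainCost f x x ≤ 0 := by
  simp only [le_iff_forall_pos_lt_add, zero_add, chainCost_lt_iff]
  rfl

theorem chainCost_le_chainCost_add_dist : chainCost f x z ≤ chainCost f x y + dist y z :=
  le_of_forall_pos_lt_add fun ε hε => by
    rw [add_right_comm]
    exact chainCost_lt_iff.2 ((chainCost_lt_iff.1 (lt_add_of_pos_right _ hε)).add_dist z)

theorem chainCost_apply_le : chainCost f x (f y) ≤ chainCost f x y :=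
  le_of_forall_gt fun ε hε =>
    chainCost_lt_iff.2 (by simpa using (chainCost_lt_iff.1 hε).snoc (f y))

theorem chainCost_apply_self_le : chainCost f x (f x) ≤ 0 :=
  le_of_forall_gt fun _ hε => chainCost_lt_iff.2 (.single (by simpa using hε))

theorem isLyapunov_chainCost (f : X → X) (x : X) : IsLyapunov f (chainCost f x) := by
  refine ⟨(LipschitzWith.of_le_add fun y z => ?_).continuous, fun _ => chainCost_apply_le⟩
  rw [dist_comm]
  exact chainCost_le_chainCost_add_dist

theorem notMem_neutralSet_chainCost (h : x ∉ strongChainRecurrentSet dist f) :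
    x ∉ neutralSet f (chainCost f x) := fun heq =>
  h (mem_strongChainRecurrentSet_iff_chainCost_le.2 (heq.symm.trans_le chainCost_apply_self_le))

end ChainCost

section GeneralizedRecurrentSet

theorem exists_metricSpace_dist_apply_le [t : TopologicalSpace X] [MetrizableSpace X] {u : X → ℝ}
    (hu : Continuous u) : ∃ m : MetricSpace X, m.toUniformSpace.toTopologicalSpace = t ∧
      ∀ x y, dist (u x) (u y) ≤ m.dist x y := by
  let := metrizableSpaceMetric X
  exact ⟨(isEmbedding_graph hu).comapMetricSpace, rfl, fun x y => le_max_right _ _⟩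

variable [TopologicalSpace X]

theorem generalizedRecurrentSet_subset_neutralSet [MetrizableSpace X] {u : X → ℝ}
    (hu : IsLyapunov f u) : generalizedRecurrentSet f ⊆ neutralSet f u := by
  intro x hx
  obtain ⟨m, hm, hum⟩ := exists_metricSpace_dist_apply_le hu.1
  have hud : ∀ x y, u y ≤ u x + m.dist x y := fun x y => by
    have := (neg_abs_le (u x - u y)).trans' (neg_le_neg (hum x y))
    linarith
  exact (hu.2 x).antisymm <| le_of_forall_pos_lt_add fun ε hε =>
    (hx m hm ε hε).apply_lt_apply_map_add hu.2 hud

theorem mem_generalizedRecurrentSet_iff [MetrizableSpace X] :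
    x ∈ generalizedRecurrentSet f ↔ ∀ u, IsLyapunov f u → x ∈ neutralSet f u := by
  refine ⟨fun hx u hu => generalizedRecurrentSet_subset_neutralSet hu hx, fun hx m hm => ?_⟩
  subst hm
  by_contra hnot
  exact notMem_neutralSet_chainCost hnot (hx _ (isLyapunov_chainCost f x))

theorem admitsStrictLyapunov_iff [MetrizableSpace X] (f : X → X) :
    AdmitsStrictLyapunov f ↔ generalizedRecurrentSet f ≠ univ := by
  simp only [AdmitsStrictLyapunov, ne_univ_iff_exists_notMem, mem_generalizedRecurrentSet_iff,
    not_forall, exists_prop]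
  tauto

end GeneralizedRecurrentSet

end Recurrence

section TrappingRegion

variable {X : Type*} [TopologicalSpace X] {f : X → X}

/-- The Birkhoff sums of a Lyapunov function for an iterate telescope. -/
theorem AdmitsStrictLyapunov.of_iterate (hf : Continuous f) {k : ℕ}
    (h : AdmitsStrictLyapunov f^[k]) : AdmitsStrictLyapunov f := by
  obtain ⟨u, ⟨huc, hu⟩, hne⟩ := h
  have hsub := birkhoffSum_apply_sub_birkhoffSum f u k
  refine ⟨birkhoffSum f u k,
    ⟨continuous_finsetSum _ fun i _ => huc.comp (hf.iterate i), fun x => ?_⟩, ?_⟩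
  · linarith [hsub x, hu x]
  · have : neutralSet f (birkhoffSum f u k) = neutralSet f^[k] u := by
      ext x
      exact sub_eq_zero.symm.trans (by rw [hsub, sub_eq_zero]; rfl)
    rwa [this]

theorem admitsStrictLyapunov_of_closure_image_subset [NormalSpace X] {A W : Set X}
    (hW : IsOpen W) (hWA : W ⊂ A) (h : closure (f '' A) ⊆ W) : AdmitsStrictLyapunov f := by
  obtain ⟨u, hu₀, hu₁, hu⟩ := exists_continuous_zero_one_of_isClosed isClosed_closure
    hW.isClosed_compl (disjoint_compl_right_iff_subset.2 h)
  have hu₀ : ∀ x ∈ A, u (f x) = 0 := fun x hx => hu₀ (subset_closure (mem_image_of_mem f hx))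
  refine ⟨u, ⟨u.continuous, fun x => ?_⟩, ?_⟩
  · by_cases hx : x ∈ A
    · exact (hu₀ x hx).trans_le (hu x).1
    · exact (hu _).2.trans_eq (hu₁ fun hxW => hx (hWA.1 hxW)).symm
  · obtain ⟨x, hxA, hxW⟩ := exists_of_ssubset hWA
    refine (ne_univ_iff_exists_notMem _).2 ⟨x, fun heq => zero_ne_one (α := ℝ) ?_⟩
    exact (hu₀ x hxA).symm.trans (Eq.trans heq (hu₁ hxW))

end TrappingRegion

section HomeoSpace

/-- The map `f ↦ (f, f⁻¹)`. It is isometric for `d_H` and the sup metrics, and has closed range. -/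
def toContinuousMapPair {X : Type*} [TopologicalSpace X] (f : X ≃ₜ X) : C(X, X) × C(X, X) :=
  (f, f.symm)

theorem range_toContinuousMapPair {X : Type*} [TopologicalSpace X] :
    range (toContinuousMapPair (X := X)) =
      {p | p.1.comp p.2 = ContinuousMap.id X ∧ p.2.comp p.1 = ContinuousMap.id X} := by
  ext ⟨F, G⟩
  constructor
  · rintro ⟨f, hf⟩
    obtain ⟨rfl, rfl⟩ := Prod.mk.inj hf
    exact ⟨ContinuousMap.ext f.apply_symm_apply, ContinuousMap.ext f.symm_apply_apply⟩
  · rintro ⟨hFG, hGF⟩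
    exact ⟨⟨⟨F, G, DFunLike.congr_fun hGF, DFunLike.congr_fun hFG⟩, F.continuous, G.continuous⟩,
      rfl⟩

variable {X : Type*} [MetricSpace X] [CompactSpace X]

theorem isometry_toContinuousMapPair : Isometry (toContinuousMapPair (X := X)) := by
  refine Isometry.of_dist_eq fun f g => le_antisymm (max_le ?_ ?_) ?_
  · exact (ContinuousMap.dist_le dist_nonneg).2 fun x =>
      (le_max_left _ _).trans (le_homeoDist f g x)
  · exact (ContinuousMap.dist_le dist_nonneg).2 fun x =>
      (le_max_right _ _).trans (le_homeoDist f g x)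
  · refine Real.iSup_le (fun x => max_le_max ?_ ?_) dist_nonneg
    · exact ContinuousMap.dist_apply_le_dist (f := (f : C(X, X))) (g := g) x
    · exact ContinuousMap.dist_apply_le_dist (f := (f.symm : C(X, X))) (g := g.symm) x

theorem completeSpace_homeomorph : CompleteSpace (X ≃ₜ X) := by
  rw [completeSpace_iff_isComplete_range isometry_toContinuousMapPair.isUniformInducing,
    range_toContinuousMapPair]
  refine IsClosed.isComplete (.inter (isClosed_eq ?_ continuous_const)
    (isClosed_eq ?_ continuous_const))
  · exact continuous_fst.compCM continuous_snd
  · exact continuous_snd.compCM continuous_fst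

theorem continuous_homeomorph_toContinuousMap : Continuous fun f : X ≃ₜ X => (f : C(X, X)) :=
  continuous_fst.comp isometry_toContinuousMapPair.continuous

theorem continuous_homeomorph_trans_left (f : X ≃ₜ X) : Continuous fun h : X ≃ₜ X => f.trans h := by
  have hpair := isometry_toContinuousMapPair.continuous (α := X ≃ₜ X)
  refine isometry_toContinuousMapPair.isUniformInducing.isInducing.continuous_iff.2 (.prodMk ?_ ?_)
  · exact (continuous_fst.comp hpair).compCM (continuous_const (y := (f : C(X, X))))
  · exact (continuous_const (y := (f.symm : C(X, X)))).compCM (continuous_snd.comp hpair)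

theorem dist_refl_le {h : X ≃ₜ X} {r : ℝ} (hr : 0 ≤ r) (hh : ∀ x, dist (h x) x ≤ r) :
    dist (Homeomorph.refl X) h ≤ r := by
  refine Real.iSup_le (fun x => max_le ?_ ?_) hr
  · simpa [dist_comm] using hh x
  · simpa using hh (h.symm x)

theorem continuous_homeomorph_iterate (k : ℕ) :
    Continuous fun g : X ≃ₜ X => (⟨g^[k], g.continuous.iterate k⟩ : C(X, X)) := by
  induction k with
  | zero => exact continuous_const (y := ContinuousMap.id X)
  | succ k ih => exact ih.compCM continuous_homeomorph_toContinuousMap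

/-- The homeomorphisms with an attracting block of some period: an iterate maps a compact set `A`
into an open proper subset of `A`. -/
def trappingSet (X : Type*) [TopologicalSpace X] : Set (X ≃ₜ X) :=
  {g | ∃ (k : ℕ) (A W : Set X), IsCompact A ∧ IsOpen W ∧ W ⊂ A ∧ MapsTo g^[k] A W}

theorem isOpen_trappingSet : IsOpen (trappingSet X) := by
  refine isOpen_iff_mem_nhds.2 fun g ⟨k, A, W, hA, hW, hWA, hmaps⟩ => ?_
  filter_upwards [(continuous_homeomorph_iterate k).continuousAt.eventually
    (ContinuousMap.eventually_mapsTo hA hW hmaps)] with g' hg'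
  exact ⟨k, A, W, hA, hW, hWA, hg'⟩

theorem admitsStrictLyapunov_of_mem_trappingSet {X : Type*} [TopologicalSpace X] [T4Space X]
    {g : X ≃ₜ X} (hg : g ∈ trappingSet X) : AdmitsStrictLyapunov g := by
  obtain ⟨k, A, W, hA, hW, hWA, hmaps⟩ := hg
  have hgk := g.continuous.iterate k
  have hclosure : closure (g^[k] '' A) ⊆ W := by
    rw [(hA.image hgk).isClosed.closure_eq]
    exact hmaps.image_subset
  exact .of_iterate g.continuous (admitsStrictLyapunov_of_closure_image_subset hW hWA hclosure)

end HomeoSpace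

section Contraction

variable {E : Type*} [NormedAddCommGroup E] [NormedSpace ℝ E] {p q : ℝ} {x : E}

/-- The radial map which is the identity off the unit ball and raises the norm to the power `p`
inside it. Its value at `0` is `0` for every `p`. -/
noncomputable def radialPow (p : ℝ) (x : E) : E :=
  min 1 ‖x‖ ^ (p - 1) • x

theorem continuous_radialPow (hp : 1 ≤ p) : Continuous (radialPow p : E → E) :=
  ((continuous_const.min continuous_norm).rpow_const fun _ => .inr (by linarith)).smul continuous_id

theorem radialPow_of_one_le_norm (hx : 1 ≤ ‖x‖) : radialPow p x = x := by
  rw [radialPow, min_eq_left hx, Real.one_rpow, one_smul]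

theorem norm_radialPow_of_norm_le_one (hp : p ≠ 0) (hx : ‖x‖ ≤ 1) :
    ‖radialPow p x‖ = ‖x‖ ^ p := by
  rcases (norm_nonneg x).eq_or_lt' with h₀ | h₀
  · simp [radialPow, norm_eq_zero.1 h₀, hp]
  · rw [radialPow, min_eq_right hx, norm_smul, Real.norm_of_nonneg (by positivity),
      Real.rpow_sub_one h₀.ne', div_mul_cancel₀ _ h₀.ne']

theorem radialPow_radialPow (hp : 0 < p) :
    radialPow q (radialPow p x) = radialPow (p * q) x := by
  rcases le_or_gt 1 ‖x‖ with hx | hx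
  · simp only [radialPow_of_one_le_norm hx]
  rcases eq_or_ne x 0 with rfl | h₀
  · simp [radialPow]
  have h₀ : 0 < ‖x‖ := norm_pos_iff.2 h₀
  have hnorm := norm_radialPow_of_norm_le_one hp.ne' hx.le
  have hle : ‖x‖ ^ p ≤ 1 := Real.rpow_le_one h₀.le hx.le hp.le
  rw [radialPow, hnorm, min_eq_right hle, radialPow, radialPow, min_eq_right hx.le, smul_smul,
    ← Real.rpow_mul h₀.le, ← Real.rpow_add h₀]
  ring_nf

theorem radialPow_one : radialPow 1 x = x := by
  simp [radialPow]

/-- `radialPow p` as a permutation, with inverse `radialPow p⁻¹`. -/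
noncomputable def radialPowPerm (hp : 0 < p) : Equiv.Perm E where
  toFun := radialPow p
  invFun := radialPow p⁻¹
  left_inv x := by rw [radialPow_radialPow hp, mul_inv_cancel₀ hp.ne', radialPow_one]
  right_inv x := by rw [radialPow_radialPow (inv_pos.2 hp), inv_mul_cancel₀ hp.ne', radialPow_one]

theorem exists_perm_mapsTo_ball (b : E) {R r : ℝ} (hR : 0 < R) (hr : 0 < r) :
    ∃ η : Equiv.Perm E, Continuous η ∧ (∀ x ∉ Metric.closedBall b (2 * R), η x = x) ∧
      MapsTo η (Metric.ball b R) (Metric.ball b r) := by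
  have hR2 : 0 < 2 * R := by positivity
  obtain ⟨p, hp, hpr⟩ : ∃ p : ℝ, 1 ≤ p ∧ (1 / 2 : ℝ) ^ p < r / (2 * R) :=
    ((eventually_ge_atTop 1).and ((tendsto_rpow_atTop_of_base_lt_one (1 / 2) (by norm_num)
      (by norm_num)).eventually_lt_const (div_pos hr hR2))).exists
  have hp₀ : 0 < p := by linarith
  let e : E ≃ₜ E := (Homeomorph.smulOfNeZero (2 * R) hR2.ne').trans (Homeomorph.addRight b)
  have hdist : ∀ y, dist (e y) b = 2 * R * ‖y‖ := fun y => by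
    simp [e, norm_smul, abs_of_pos hR]
  refine ⟨e.symm.toEquiv.trans ((radialPowPerm hp₀).trans e.toEquiv),
    e.continuous.comp ((continuous_radialPow hp).comp e.symm.continuous),
    e.surjective.forall.2 fun y hy => ?_, e.surjective.forall.2 fun y hy => ?_⟩
  · rw [Metric.mem_closedBall, hdist, mul_le_iff_le_one_right hR2, not_le] at hy
    simp [radialPowPerm, radialPow_of_one_le_norm hy.le]
  · have hy : ‖y‖ < 1 / 2 := by
      rw [Metric.mem_ball, hdist] at hy
      nlinarith
    have hnorm : ‖radialPow p y‖ < r / (2 * R) := by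
      rw [norm_radialPow_of_norm_le_one hp₀.ne' (by linarith)]
      exact (Real.rpow_le_rpow (norm_nonneg y) hy.le hp₀.le).trans_lt hpr
    rw [lt_div_iff₀' hR2, ← hdist] at hnorm
    simpa [radialPowPerm] using hnorm

end Contraction

section Extension

theorem properSpace_of_isOpenEmbedding {E X : Type*} [NormedAddCommGroup E] [NormedSpace ℝ E]
    [TopologicalSpace X] [LocallyCompactSpace X] {Φ : E → X} (hΦ : IsOpenEmbedding Φ) :
    ProperSpace E :=
  have := hΦ.locallyCompactSpace
  .of_locallyCompactSpace ℝ

variable {X : Type*} [TopologicalSpace X] [T2Space X] [CompactSpace X]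

theorem exists_homeomorph_extension {Y : Type*} [TopologicalSpace Y] {Φ : Y → X}
    (hΦ : IsOpenEmbedding Φ) {η : Equiv.Perm Y} (hη : Continuous η) {K : Set Y} (hK : IsCompact K)
    (hηK : ∀ y ∉ K, η y = y) :
    ∃ h : X ≃ₜ X, (∀ y, h (Φ y) = Φ (η y)) ∧ ∀ x ∉ Φ '' K, h x = x := by
  let e : Equiv.Perm X := η.viaEmbedding ⟨Φ, hΦ.injective⟩
  have he : ∀ y, e (Φ y) = Φ (η y) := η.viaEmbedding_apply ⟨Φ, hΦ.injective⟩
  have heK : ∀ x ∉ Φ '' K, e x = x := by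
    intro x hx
    by_cases hxΦ : x ∈ range Φ
    · obtain ⟨y, rfl⟩ := hxΦ
      rw [he, hηK y fun hy => hx (mem_image_of_mem Φ hy)]
    · exact η.viaEmbedding_apply_of_notMem _ x hxΦ
  have hcont : Continuous e := continuous_iff_continuousAt.2 fun x => by
    by_cases hx : x ∈ Φ '' K
    · obtain ⟨y, -, rfl⟩ := hx
      rw [← hΦ.continuousAt_iff]
      exact ((hΦ.continuous.comp hη).congr fun y => (he y).symm).continuousAt
    · have : ∀ᶠ y in 𝓝 x, y ∉ Φ '' K :=
        (hK.image hΦ.continuous).isClosed.isOpen_compl.mem_nhds hx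
      exact continuousAt_id.congr (this.mono fun y hy => (heK y hy).symm)
  exact ⟨hcont.homeoOfEquivCompactToT2, he, heK⟩

theorem exists_homeomorph_mapsTo_image_ball {E : Type*} [NormedAddCommGroup E] [NormedSpace ℝ E]
    {Φ : E → X} (hΦ : IsOpenEmbedding Φ) (b : E) {R r : ℝ} (hR : 0 < R) (hr : 0 < r) :
    ∃ h : X ≃ₜ X, (∀ x ∉ Φ '' Metric.closedBall b (2 * R), h x = x) ∧
      MapsTo h (Φ '' Metric.ball b R) (Φ '' Metric.ball b r) := by
  have := properSpace_of_isOpenEmbedding hΦ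
  obtain ⟨η, hη, hηK, hηr⟩ := exists_perm_mapsTo_ball b hR hr
  obtain ⟨h, hΦη, hhK⟩ := exists_homeomorph_extension hΦ hη (isCompact_closedBall b _) hηK
  refine ⟨h, hhK, ?_⟩
  rintro _ ⟨x, hx, rfl⟩
  exact ⟨η x, hηr hx, (hΦη x).symm⟩

end Extension

section Closing

theorem iterate_comp_eq_of_forall_eq {X : Type*} {f h : X → X} {x : X} {k : ℕ} (hk : 0 < k)
    (hfix : ∀ i, 0 < i → i < k → h (f^[i] x) = f^[i] x) : (h ∘ f)^[k] x = h (f^[k] x) := by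
  induction k, hk using Nat.le_induction with
  | base => rfl
  | succ k hk ih =>
    rw [Function.iterate_succ_apply', ih fun i hi hik => hfix i hi (by omega),
      hfix k hk k.lt_succ_self, Function.comp_apply, ← Function.iterate_succ_apply' f]

variable {X : Type*} [TopologicalSpace X] [T2Space X] [CompactSpace X]
  {E : Type*} [NormedAddCommGroup E] [NormedSpace ℝ E] {Φ : E → X} {f : X → X} {k : ℕ}

theorem exists_closedBall_forall_first_return (hΦ : IsOpenEmbedding Φ) (hf : Continuous f)
    {a b : E} {R : ℝ} (hret : f^[k] (Φ b) = Φ a) (ha : a ∈ Metric.ball b R)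
    (hav : ∀ i, 0 < i → i < k → f^[i] (Φ b) ∉ range Φ) :
    ∃ r, 0 < r ∧ ∀ x ∈ Metric.closedBall b r, f^[k] (Φ x) ∈ Φ '' Metric.ball b R ∧
      ∀ i, 0 < i → i < k → f^[i] (Φ x) ∉ Φ '' Metric.closedBall b (2 * R) := by
  have := properSpace_of_isOpenEmbedding hΦ
  have hfΦ : ∀ i, ContinuousAt (fun x => f^[i] (Φ x)) b := fun i =>
    ((hf.iterate i).comp hΦ.continuous).continuousAt
  have hclosed : IsClosed (Φ '' Metric.closedBall b (2 * R)) :=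
    ((isCompact_closedBall b _).image hΦ.continuous).isClosed
  have hreturn : ∀ᶠ x in 𝓝 b, f^[k] (Φ x) ∈ Φ '' Metric.ball b R :=
    (hfΦ k).eventually_mem <| (hΦ.isOpenMap _ Metric.isOpen_ball).mem_nhds <|
      hret ▸ mem_image_of_mem Φ ha
  have havoid : ∀ᶠ x in 𝓝 b, ∀ i ∈ Ioo 0 k, f^[i] (Φ x) ∉ Φ '' Metric.closedBall b (2 * R) :=
    (eventually_all_finite (finite_Ioo 0 k)).2 fun i hi =>
      (hfΦ i).eventually_mem <| hclosed.isOpen_compl.mem_nhds fun h =>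
        hav i hi.1 hi.2 (image_subset_range _ _ h)
  obtain ⟨r, hr, hball⟩ :=
    Metric.nhds_basis_closedBall.eventually_iff.1 (hreturn.and havoid)
  exact ⟨r, hr, fun x hx => ⟨(hball hx).1, fun i h₀ hik => (hball hx).2 i ⟨h₀, hik⟩⟩⟩

/-- The perturbation squeezes a ball around `y`, which `f^[k]` has brought back into the cell, into
a smaller ball around `y`. The orbit segment misses the cell in between, so it is not altered. -/
theorem exists_trans_mem_trappingSet [Nontrivial E] (hΦ : IsOpenEmbedding Φ) (f : X ≃ₜ X) {y : X}
    (hk : 0 < k) (hy : y ∈ range Φ) (hret : f^[k] y ∈ range Φ)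
    (hav : ∀ i, 0 < i → i < k → f^[i] y ∉ range Φ) :
    ∃ h : X ≃ₜ X, (∀ x ∉ range Φ, h x = x) ∧ f.trans h ∈ trappingSet X := by
  have := properSpace_of_isOpenEmbedding hΦ
  obtain ⟨b, rfl⟩ := hy
  obtain ⟨a, ha⟩ := hret
  obtain ⟨r, hr, hball⟩ := exists_closedBall_forall_first_return (R := dist a b + 1) hΦ f.continuous
    ha.symm (lt_add_one (dist a b)) hav
  obtain ⟨h, hfix, hmaps⟩ :=
    exists_homeomorph_mapsTo_image_ball hΦ b (R := dist a b + 1) (by positivity) hr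
  have hssubset : Metric.ball b r ⊂ Metric.closedBall b r := by
    obtain ⟨x, hx⟩ := NormedSpace.sphere_nonempty (x := b).2 hr.le
    exact ssubset_iff_exists.2 ⟨Metric.ball_subset_closedBall, x,
      Metric.sphere_subset_closedBall hx, fun hx' => (Metric.mem_ball.1 hx').ne hx⟩
  refine ⟨h, fun x hx => hfix x fun hx' => hx (image_subset_range _ _ hx'),
    k, Φ '' Metric.closedBall b r, Φ '' Metric.ball b r,
    (isCompact_closedBall b r).image hΦ.continuous, hΦ.isOpenMap _ Metric.isOpen_ball,
    hΦ.injective.image_strictMono hssubset, ?_⟩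
  rintro _ ⟨x, hx, rfl⟩
  obtain ⟨hreturn, havoid⟩ := hball x hx
  have hiter : (f.trans h)^[k] (Φ x) = h (f^[k] (Φ x)) :=
    iterate_comp_eq_of_forall_eq hk fun i h₀ hik => hfix _ (havoid i h₀ hik)
  rw [hiter]
  exact hmaps hreturn

end Closing

section Density

theorem exists_first_return {α ι : Type*} [Finite ι] {C : ι → Set α} {x : ℕ → α}
    (hx : ∀ n, x n ∈ ⋃ i, C i) :
    ∃ i n k, 0 < k ∧ x n ∈ C i ∧ x (n + k) ∈ C i ∧ ∀ j, 0 < j → j < k → x (n + j) ∉ C i := by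
  classical
  choose i hi using fun n => mem_iUnion.1 (hx n)
  obtain ⟨m, n, hmn, heq⟩ : ∃ m n, m < n ∧ i m = i n := by
    obtain ⟨m, n, hne, heq⟩ := Finite.exists_ne_map_eq_of_infinite i
    exact hne.lt_or_gt.elim (fun h => ⟨m, n, h, heq⟩) fun h => ⟨n, m, h, heq.symm⟩
  have hreturn : ∃ k, 0 < k ∧ x (m + k) ∈ C (i m) :=
    ⟨n - m, by omega, by rw [Nat.add_sub_cancel' hmn.le, heq]; exact hi n⟩
  exact ⟨i m, m, Nat.find hreturn, (Nat.find_spec hreturn).1, hi m, (Nat.find_spec hreturn).2,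
    fun j h₀ hj hmem => Nat.find_min hreturn hj ⟨h₀, hmem⟩⟩

theorem dense_setOf_forall_iterate_mem {X : Type*} [TopologicalSpace X] [BaireSpace X] {f : X → X}
    (hf : Continuous f) (hfo : IsOpenMap f) {D : Set X} (hDo : IsOpen D) (hD : Dense D) :
    Dense {x | ∀ n, f^[n] x ∈ D} := by
  have hdense : ∀ n, Dense (f^[n] ⁻¹' D) := fun n => by
    induction n with
    | zero => exact hD
    | succ n ih => exact ih.preimage hfo
  convert dense_iInter_of_isOpen (fun n => hDo.preimage (hf.iterate n)) hdense
  ext x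
  simp

theorem dist_apply_self_le_of_eq_off {X : Type*} [PseudoMetricSpace X] {h : X → X}
    (hinj : Function.Injective h) {s : Set X} {z : X} {ρ : ℝ} (hρ : 0 ≤ ρ)
    (hs : s ⊆ Metric.ball z ρ) (hoff : ∀ x ∉ s, h x = x) (x : X) : dist (h x) x ≤ 2 * ρ := by
  by_cases hx : x ∈ s
  · have hhx : h x ∈ s := by
      by_contra hhx
      exact hhx ((hinj (hoff _ hhx)).symm ▸ hx)
    linarith [Metric.mem_ball.1 (hs hx), Metric.mem_ball.1 (hs hhx), dist_triangle_right (h x) x z]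
  · rw [hoff x hx, dist_self]
    positivity

/-- Every neighbourhood of every point `z` contains an open cell modelled on `E` whose closure is a
neighbourhood of `z`. At a boundary point the cell itself cannot contain `z`. -/
def HasDenseCells (E X : Type*) [TopologicalSpace E] [TopologicalSpace X] : Prop :=
  ∀ z : X, ∀ U ∈ 𝓝 z, ∃ Φ : E → X, IsOpenEmbedding Φ ∧ range Φ ⊆ U ∧ closure (range Φ) ∈ 𝓝 z

theorem HasDenseCells.exists_finset_dense_iUnion {E X : Type*} [TopologicalSpace E]
    [PseudoMetricSpace X] [CompactSpace X] (hX : HasDenseCells E X) {ρ : ℝ} (hρ : 0 < ρ) :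
    ∃ (t : Finset X) (Φ : X → E → X), (∀ z, IsOpenEmbedding (Φ z)) ∧
      (∀ z, range (Φ z) ⊆ Metric.ball z ρ) ∧ Dense (⋃ z : t, range (Φ z)) := by
  choose Φ hΦ hΦρ hcl using fun z => hX z _ (Metric.ball_mem_nhds z hρ)
  obtain ⟨t, ht⟩ := CompactSpace.elim_nhds_subcover _ hcl
  refine ⟨t, Φ, hΦ, hΦρ, fun x => ?_⟩
  obtain ⟨z, hz, hx⟩ := mem_iUnion₂.1 (ht.ge (mem_univ x))
  exact closure_mono (subset_iUnion (fun z : t => range (Φ z)) ⟨z, hz⟩) hx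

variable {E : Type*} [NormedAddCommGroup E] [NormedSpace ℝ E] [Nontrivial E]
  {X : Type*} [MetricSpace X] [CompactSpace X] [Nonempty X]

theorem HasDenseCells.exists_dist_refl_lt_and_trans_mem_trappingSet (hX : HasDenseCells E X)
    (f : X ≃ₜ X) {ε : ℝ} (hε : 0 < ε) :
    ∃ h : X ≃ₜ X, dist (Homeomorph.refl X) h < ε ∧ f.trans h ∈ trappingSet X := by
  obtain ⟨t, Φ, hΦ, hΦε, hdense⟩ := hX.exists_finset_dense_iUnion (show 0 < ε / 3 by positivity)
  obtain ⟨x, hx⟩ := (dense_setOf_forall_iterate_mem f.continuous f.isOpenMap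
    (isOpen_iUnion fun z : t => (hΦ z).isOpen_range) hdense).nonempty
  obtain ⟨z, n, k, hk, hn, hnk, hav⟩ := exists_first_return hx
  have hiter : ∀ i, f^[n + i] x = f^[i] (f^[n] x) := fun i => by
    rw [add_comm, Function.iterate_add_apply]
  simp only [hiter] at hnk hav
  obtain ⟨h, hoff, hmem⟩ := exists_trans_mem_trappingSet (hΦ z) f hk hn hnk hav
  have hdist := dist_refl_le (by positivity)
    (dist_apply_self_le_of_eq_off h.injective (by positivity) (hΦε z) hoff)
  exact ⟨h, by linarith, hmem⟩

theorem HasDenseCells.dense_trappingSet (hX : HasDenseCells E X) : Dense (trappingSet X) := by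
  refine fun f => mem_closure_iff_nhds.2 fun U hU => ?_
  obtain ⟨ε, hε, hball⟩ := Metric.mem_nhds_iff.1
    ((continuous_homeomorph_trans_left f).continuousAt (x := Homeomorph.refl X) hU)
  obtain ⟨h, hdist, hmem⟩ := hX.exists_dist_refl_lt_and_trans_mem_trappingSet f hε
  exact ⟨f.trans h, hball (Metric.mem_ball'.2 hdist), hmem⟩

theorem HasDenseCells.setOf_admitsStrictLyapunov_mem_residual (hX : HasDenseCells E X) :
    {f : X ≃ₜ X | AdmitsStrictLyapunov f} ∈ residual (X ≃ₜ X) :=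
  mem_of_superset (residual_of_dense_open isOpen_trappingSet hX.dense_trappingSet) fun _ hf =>
    admitsStrictLyapunov_of_mem_trappingSet hf

end Density

section Manifold

theorem exists_isOpenEmbedding_range_eq_of_convex {E : Type*} [NormedAddCommGroup E]
    [NormedSpace ℝ E] {C : Set E} (hC : Convex ℝ C) (ho : IsOpen C) (hne : C.Nonempty)
    (hb : Bornology.IsBounded C) : ∃ ψ : E → E, IsOpenEmbedding ψ ∧ range ψ = C := by
  obtain ⟨h, hh, -⟩ := exists_homeomorph_image_interior_closure_frontier_eq_unitBall hC
    (by rwa [ho.interior_eq]) hb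
  have hball : range (OpenPartialHomeomorph.univUnitBall (E := E)) = Metric.ball 0 1 := by
    rw [← image_univ]
    exact OpenPartialHomeomorph.univUnitBall.image_source_eq_target
  refine ⟨h.symm ∘ OpenPartialHomeomorph.univUnitBall,
    h.symm.isOpenEmbedding.comp (OpenPartialHomeomorph.univUnitBall.isOpenEmbedding rfl), ?_⟩
  rw [range_comp, hball, ← hh, ho.interior_eq, ← image_comp, h.symm_comp_self, image_id]

theorem isOpenEmbedding_extChartAt_symm_comp {𝕜 E H M Y : Type*} [NontriviallyNormedField 𝕜]
    [NormedAddCommGroup E] [NormedSpace 𝕜 E] [TopologicalSpace H] (I : ModelWithCorners 𝕜 E H)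
    [TopologicalSpace M] [ChartedSpace H M] [TopologicalSpace Y] {z : M} {ψ : Y → E}
    (hψ : IsOpenEmbedding ψ) (hψz : range ψ ⊆ (extChartAt I z).target) :
    IsOpenEmbedding ((extChartAt I z).symm ∘ ψ) := by
  have hmem : ∀ y, ψ y ∈ (extChartAt I z).target := fun y => hψz (mem_range_self y)
  refine .of_continuous_injective_isOpenMap ?_ ?_ fun V hV => ?_
  · exact (continuousOn_extChartAt_symm z).comp_continuous hψ.continuous hmem
  · exact fun y y' heq => hψ.injective ((extChartAt I z).symm.injOn (hmem y) (hmem y') heq)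
  · rw [image_comp, (extChartAt I z).symm_image_eq_source_inter_preimage
      ((image_subset_range ψ V).trans hψz)]
    exact isOpen_extChartAt_preimage' z (hψ.isOpenMap V hV)

variable {E : Type*} [NormedAddCommGroup E] [NormedSpace ℝ E] {H : Type*} [TopologicalSpace H]

theorem range_inter_ball_subset_closure (I : ModelWithCorners ℝ E H) (y : E) (r : ℝ) :
    range I ∩ Metric.ball y r ⊆ closure (interior (range I) ∩ Metric.ball y r) := fun x hx => by
  rw [inter_comm (interior _)]
  exact Metric.isOpen_ball.inter_closure ⟨hx.2, I.range_subset_closure_interior hx.1⟩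

theorem hasDenseCells_of_chartedSpace (I : ModelWithCorners ℝ E H) {M : Type*} [TopologicalSpace M]
    [ChartedSpace H M] : HasDenseCells E M := by
  intro z U hU
  set e := extChartAt I z
  obtain ⟨r, hr, hball⟩ : ∃ r > 0, Metric.ball (e z) r ∩ range I ⊆ e.target ∩ e.symm ⁻¹' U := by
    refine Metric.mem_nhdsWithin_iff.1 (inter_mem (extChartAt_target_mem_nhdsWithin z)
      ((continuousAt_extChartAt_symm z).continuousWithinAt.preimage_mem_nhdsWithin ?_))
    rwa [extChartAt_to_inv]
  set C := interior (range I) ∩ Metric.ball (e z) r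
  have hCsub : C ⊆ e.target ∩ e.symm ⁻¹' U := fun y hy => hball ⟨hy.2, interior_subset hy.1⟩
  have hCcl := range_inter_ball_subset_closure I (e z) r
  have hne : C.Nonempty := closure_nonempty_iff.1
    ⟨_, hCcl ⟨extChartAt_target_subset_range z (mem_extChartAt_target z), Metric.mem_ball_self hr⟩⟩
  obtain ⟨ψ, hψ, hψC⟩ := exists_isOpenEmbedding_range_eq_of_convex
    (I.convex_range.interior.inter (convex_ball _ _)) (isOpen_interior.inter Metric.isOpen_ball)
    hne (Metric.isBounded_ball.subset inter_subset_right)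
  have hrange : range (e.symm ∘ ψ) = e.symm '' C := by rw [range_comp, hψC]
  refine ⟨e.symm ∘ ψ, isOpenEmbedding_extChartAt_symm_comp I hψ ?_, ?_, ?_⟩
  · exact hψC.trans_subset fun y hy => (hCsub hy).1
  · exact hrange.trans_subset (image_subset_iff.2 fun y hy => (hCsub hy).2)
  · rw [hrange]
    have hopen : IsOpen (e.source ∩ e ⁻¹' Metric.ball (e z) r) :=
      isOpen_extChartAt_preimage' z Metric.isOpen_ball
    filter_upwards [hopen.mem_nhds ⟨mem_extChartAt_source z, Metric.mem_ball_self hr⟩]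
      with x ⟨hxs, hxr⟩
    have hxt : e x ∈ e.target := e.map_source hxs
    have hcont : ContinuousWithinAt e.symm C (e x) :=
      (continuousOn_extChartAt_symm z _ hxt).mono fun y hy => (hCsub hy).1
    have := hcont.mem_closure_image (hCcl ⟨extChartAt_target_subset_range z hxt, hxr⟩)
    rwa [e.left_inv hxs] at this

end Manifold

end GenericLyapunov

theorem mainTheorem10_general {E : Type*} [NormedAddCommGroup E] [NormedSpace ℝ E] [Nontrivial E]
    {X : Type*} [MetricSpace X] [CompactSpace X] [Nonempty X]
    (hX : GenericLyapunov.HasDenseCells E X) :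
    CompleteSpace (X ≃ₜ X) ∧
    (∀ f : X ≃ₜ X, GenericLyapunov.AdmitsStrictLyapunov f ↔
      GenericLyapunov.generalizedRecurrentSet f ≠ Set.univ) ∧
    {f : X ≃ₜ X | GenericLyapunov.AdmitsStrictLyapunov f} ∈ residual (X ≃ₜ X) ∧
    {f : X ≃ₜ X | GenericLyapunov.generalizedRecurrentSet f ≠ Set.univ} ∈
      residual (X ≃ₜ X) := by
  have hresidual := hX.setOf_admitsStrictLyapunov_mem_residual
  refine ⟨GenericLyapunov.completeSpace_homeomorph,
    fun f => GenericLyapunov.admitsStrictLyapunov_iff f, hresidual, ?_⟩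
  simpa only [GenericLyapunov.admitsStrictLyapunov_iff] using hresidual

theorem mainTheorem10
    {E : Type*} [NormedAddCommGroup E] [NormedSpace ℝ E] [FiniteDimensional ℝ E]
    (hdim : 0 < Module.finrank ℝ E)
    {H : Type*} [TopologicalSpace H] (I : ModelWithCorners ℝ E H)
    {M : Type*} [MetricSpace M] [CompactSpace M] [Nonempty M]
    [ChartedSpace H M] [IsManifold I ∞ M] :
    CompleteSpace (M ≃ₜ M) ∧
    (∀ f : M ≃ₜ M, GenericLyapunov.AdmitsStrictLyapunov f ↔
      GenericLyapunov.generalizedRecurrentSet f ≠ Set.univ) ∧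
    {f : M ≃ₜ M | GenericLyapunov.AdmitsStrictLyapunov f} ∈ residual (M ≃ₜ M) ∧
    {f : M ≃ₜ M | GenericLyapunov.generalizedRecurrentSet f ≠ Set.univ} ∈
      residual (M ≃ₜ M) := by
  have : Nontrivial E := Module.finrank_pos_iff.1 hdim
  exact mainTheorem10_general (GenericLyapunov.hasDenseCells_of_chartedSpace I)
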